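/- Let $\Theta$ be a measurable space, $\pi$ a probability measure on $\Theta$ (the prior), $\mathcal L:\Theta\to[0,\infty)$ a measurable likelihood function, and $0=\beta_1<\dots<\beta_T=1$ a deterministic sequence of temperatures. For $1\le t\le T$ put $$\mathcal Z_t=\int_\Theta \mathcal L(\theta)^{\beta_t}\,\pi(d\theta),\qquad p_t(d\theta)=\frac{\mathcal L(\theta)^{\beta_t}}{\mathcal Z_t}\,\pi(d\theta),$$ and let $\mathcal K_t$ be a Markov kernel on $\Theta$. Persistent sampling with $N$ particles is the following random procedure. Draw $\theta_1^1,\dots,\theta_1^N$ i.i.d. from $\pi$ and put $\hat{\mathcal Z}_1=1$. For $t=2,\dots,T$ put, for $1\le t'\le t-1$ and $1\le i\le N$, $$w_{tt'}^i=\frac{\mathcal L(\theta_{t'}^i)^{\beta_t}}{\frac1{t-1}\sum_{s=1}^{t-1}\mathcal L(\theta_{t'}^i)^{\beta_s}\,\hat{\mathcal Z}_s^{-1}},\qquad \hat{\mathcal Z}_t=\frac1{t-1}\sum_{t'=1}^{t-1}\Big(\frac1N\sum_{i=1}^N w_{tt'}^i\Big),\qquad W_{tt'}^i=\frac{w_{tt'}^i}{\hat{\mathcal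 Z}_t};$$ conditionally on everything drawn so far, draw $\tilde\theta_t^1,\dots,\tilde\theta_t^N$ independently from the $(t-1)N$ particles $\theta_{t'}^i$ with probabilities proportional to $W_{tt'}^i$ (multinomial resampling); then, conditionally on everything drawn so far, draw $\theta_t^i\sim\mathcal K_t(\tilde\theta_t^i,\cdot)$ independently for $i=1,\dots,N$. Assume: - (C1) for all $t,s\le T$ there is $M_{ts}<\infty$ with $\sup_{\theta\in\Theta}\mathcal L(\theta)^{\beta_t}/\mathcal L(\theta)^{\beta_s}\le M_{ts}$ (with $1/0=\infty$); - (C2) there is $\epsilon>0$ with $\mathcal Z_t\ge\epsilon$ for all $t\le T$; - (C3) for each $t\le T$ there are $C_t<\infty$ and $\rho_t\in(0,1)$ with $\sup_{\theta\in\Theta}\|\mathcal K_t^n(\theta,\cdot)-p_t\|_{TV}\le C_t\rho_t^n$ for all $n\ge1$, where $\|\cdot\|_{TV}$ is the total variation distance; - (C4) there is $\delta>0$ with $\beta_t-\beta_{t-1}\ge\delta$ for $2\le t\le T$. **Theorem (Consistency of normalizing constant estimates).** For every fixed $t\in\{1,\dots,T\}$, $\hat{\mathcal Z}_t$ converges in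 probability to $\mathcal Z_t$ as $N\to\infty$. -/

import Mathlib

open MeasureTheory ProbabilityTheory Filter Topology
open scoped NNReal ENNReal

namespace PersistentSampling

noncomputable section

/-! ### The annealed targets -/

/-- The normalizing constant `Z_t = ∫ L(θ)^{β_t} π(dθ)`. -/
def normConst {Θ : Type*} [MeasurableSpace Θ] (prior : Measure Θ) (L : Θ → ℝ≥0) (β : ℕ → ℝ)
    (t : ℕ) : ℝ :=
  ∫ θ, (L θ : ℝ) ^ β t ∂prior

/-- The annealed target `p_t(dθ) = L(θ)^{β_t} π(dθ) / Z_t`. -/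
def target {Θ : Type*} [MeasurableSpace Θ] (prior : Measure Θ) (L : Θ → ℝ≥0) (β : ℕ → ℝ)
    (t : ℕ) : Measure Θ :=
  prior.withDensity fun θ => ENNReal.ofReal ((L θ : ℝ) ^ β t / normConst prior L β t)

/-- Total variation distance `sup_A |μ(A) - ν(A)|`, over measurable sets `A`, of two
finite measures. -/
def tvDist {Θ : Type*} [MeasurableSpace Θ] (μ ν : Measure Θ) : ℝ :=
  ⨆ A : {A : Set Θ // MeasurableSet A}, |μ.real A - ν.real A|

/-! ### Weights and estimators, computed from an array of particles

`x t i` is the `i`-th particle of generation `t`; generations are numbered from `1`. -/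

/-- The persistent-sampling estimates: `Ẑ_1 = 1` and, for `t ≥ 2`,
`Ẑ_t = 1/(t-1) ∑_{s<t} 1/N ∑_i w_{ts}^i`, where
`w_{ts}^i = L(x_s^i)^{β_t} / (1/(t-1) ∑_{r<t} L(x_s^i)^{β_r} / Ẑ_r)`. -/
def zHat {Θ : Type*} (L : Θ → ℝ≥0) (β : ℕ → ℝ) {N : ℕ} (x : ℕ → Fin N → Θ) (t : ℕ) : ℝ :=
  if t ≤ 1 then 1 else
    1 / ((t : ℝ) - 1) * ∑ s ∈ Finset.Ico 1 t, (1 / (N : ℝ) * ∑ i : Fin N,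
      (L (x s i) : ℝ) ^ β t /
        (1 / ((t : ℝ) - 1) *
          ∑ r ∈ (Finset.Ico 1 t).attach, (L (x s i) : ℝ) ^ β r.1 * (zHat L β x r.1)⁻¹))
termination_by t
decreasing_by exact (Finset.mem_Ico.mp r.2).2

/-- The unnormalized persistent (balance-heuristic) weight `w_{ts}^i` of the `i`-th particle of
generation `s < t` at iteration `t`. -/
def weight {Θ : Type*} (L : Θ → ℝ≥0) (β : ℕ → ℝ) {N : ℕ} (x : ℕ → Fin N → Θ)
    (t s : ℕ) (i : Fin N) : ℝ :=
  (L (x s i) : ℝ) ^ β t /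
    (1 / ((t : ℝ) - 1) * ∑ r ∈ Finset.Ico 1 t, (L (x s i) : ℝ) ^ β r * (zHat L β x r)⁻¹)

theorem zHat_one {Θ : Type*} (L : Θ → ℝ≥0) (β : ℕ → ℝ) {N : ℕ} (x : ℕ → Fin N → Θ) :
    zHat L β x 1 = 1 := by
  rw [zHat]; simp

theorem zHat_eq {Θ : Type*} (L : Θ → ℝ≥0) (β : ℕ → ℝ) {N : ℕ} (x : ℕ → Fin N → Θ)
    (t : ℕ) (ht : 2 ≤ t) :
    zHat L β x t = 1 / ((t : ℝ) - 1) * ∑ s ∈ Finset.Ico 1 t,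
      (1 / (N : ℝ) * ∑ i : Fin N, weight L β x t s i) := by
  rw [zHat, if_neg (by omega)]
  simp only [weight]
  congr 1
  refine Finset.sum_congr rfl fun s _ => ?_
  congr 1
  refine Finset.sum_congr rfl fun i _ => ?_
  rw [Finset.sum_attach (Finset.Ico 1 t)
    (fun r => (L (x s i) : ℝ) ^ β r * (zHat L β x r)⁻¹)]

/-- The weight `W_{ts}^i = w_{ts}^i / Ẑ_t`. -/
def normWeight {Θ : Type*} (L : Θ → ℝ≥0) (β : ℕ → ℝ) {N : ℕ} (x : ℕ → Fin N → Θ)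
    (t s : ℕ) (i : Fin N) : ℝ :=
  weight L β x t s i / zHat L β x t

/-- The probability that one multinomial draw at iteration `t`, which selects a particle of the
generations `1, …, t-1` with probability proportional to `W_{ts}^i`, falls into `B`. -/
def resampleProb {Θ : Type*} (L : Θ → ℝ≥0) (β : ℕ → ℝ) {N : ℕ} (x : ℕ → Fin N → Θ)
    (t : ℕ) (B : Set Θ) : ℝ :=
  ∑ s ∈ Finset.Ico 1 t, ∑ i : Fin N,
    normWeight L β x t s i /
        (∑ s' ∈ Finset.Ico 1 t, ∑ j : Fin N, normWeight L β x t s' j) *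
      B.indicator (fun _ => (1 : ℝ)) (x s i)

/-! ### The algorithm -/

/-- The σ-algebra of everything drawn before iteration `t`: the particles `θ_1, …, θ_{t-1}` and
the resampled particles `θ̃_2, …, θ̃_{t-1}`. -/
@[reducible] def past {Ω Θ : Type*} [MeasurableSpace Θ] {N : ℕ} (θ θres : ℕ → Fin N → Ω → Θ) (t : ℕ) :
    MeasurableSpace Ω :=
  (⨆ s ∈ Finset.Ico 1 t, MeasurableSpace.comap (fun ω i => θ s i ω) inferInstance) ⊔
    ⨆ s ∈ Finset.Ico 2 t, MeasurableSpace.comap (fun ω i => θres s i ω) inferInstance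

/-- `(θ, θres)` is a run, on the probability space `(Ω, P)`, of persistent sampling with `N`
particles, `T` iterations, temperatures `β_1, …, β_T` and mutation kernels `K_2, …, K_T`:
* `θ_1^1, …, θ_1^N` are i.i.d. from the prior;
* for `2 ≤ t ≤ T`, conditionally on the past, `θ̃_t^1, …, θ̃_t^N` are i.i.d. draws (multinomial
  resampling) from all particles of the generations `1, …, t-1`, with probabilities
  proportional to the weights `W_{ts}^i`;
* for `2 ≤ t ≤ T`, conditionally on the past and on `θ̃_t`, the particles `θ_t^1, …, θ_t^N` are
  independent with `θ_t^i ∼ K_t(θ̃_t^i, ·)`. -/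
structure IsRun {Ω Θ : Type*} [MeasurableSpace Ω] [MeasurableSpace Θ] (P : Measure Ω)
    (prior : Measure Θ) (L : Θ → ℝ≥0) (β : ℕ → ℝ) (K : ℕ → Kernel Θ Θ) (T N : ℕ)
    (θ θres : ℕ → Fin N → Ω → Θ) : Prop where
  measurable_particle : ∀ t ∈ Finset.Icc 1 T, ∀ i, Measurable (θ t i)
  measurable_resampled : ∀ t ∈ Finset.Icc 2 T, ∀ i, Measurable (θres t i)
  init : P.map (fun ω i => θ 1 i ω) = Measure.pi (fun _ : Fin N => prior)
  resample : ∀ t ∈ Finset.Icc 2 T, ∀ B : Fin N → Set Θ, (∀ i, MeasurableSet (B i)) →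
    P[({ω | ∀ i, θres t i ω ∈ B i}).indicator (fun _ => (1 : ℝ)) | past θ θres t] =ᵐ[P]
      fun ω => ∏ i, resampleProb L β (fun s j => θ s j ω) t (B i)
  move : ∀ t ∈ Finset.Icc 2 T, ∀ B : Fin N → Set Θ, (∀ i, MeasurableSet (B i)) →
    P[({ω | ∀ i, θ t i ω ∈ B i}).indicator (fun _ => (1 : ℝ)) |
        past θ θres t ⊔ MeasurableSpace.comap (fun ω i => θres t i ω) inferInstance] =ᵐ[P]
      fun ω => ∏ i, (K t (θres t i ω)).real (B i)

/-! ### The conditions -/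

/-- Bounded likelihood ratios. The ratio is taken in `[0, ∞]`, where `1 / 0 = ∞`. -/
def LikelihoodRatioBounded {Θ : Type*} (L : Θ → ℝ≥0) (β : ℕ → ℝ) (T : ℕ) : Prop :=
  ∀ t ∈ Finset.Icc 1 T, ∀ s ∈ Finset.Icc 1 T, ∃ M : ℝ≥0,
    ⨆ θ, (L θ : ℝ≥0∞) ^ β t / (L θ : ℝ≥0∞) ^ β s ≤ (M : ℝ≥0∞)

/-- Normalizing constants bounded away from zero. -/
def NormConstPositive {Θ : Type*} [MeasurableSpace Θ] (prior : Measure Θ) (L : Θ → ℝ≥0)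
    (β : ℕ → ℝ) (T : ℕ) : Prop :=
  ∃ ε : ℝ, 0 < ε ∧ ∀ t ∈ Finset.Icc 1 T, ε ≤ normConst prior L β t

/-- Uniform geometric ergodicity of the kernel `K_t` with respect to `p_t`, for each `t ≤ T`. -/
def KernelsGeometricallyErgodic {Θ : Type*} [MeasurableSpace Θ] (prior : Measure Θ)
    (L : Θ → ℝ≥0) (β : ℕ → ℝ) (K : ℕ → Kernel Θ Θ) (T : ℕ) : Prop :=
  ∀ t ∈ Finset.Icc 1 T, ∃ C ρ : ℝ, 0 < ρ ∧ ρ < 1 ∧ ∀ n : ℕ, 1 ≤ n → ∀ θ : Θ,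
    tvDist ((K t ^ n) θ) (target prior L β t) ≤ C * ρ ^ n

/-- Annealing steps bounded below. -/
def StepsBoundedBelow (β : ℕ → ℝ) (T : ℕ) : Prop :=
  ∃ δ : ℝ, 0 < δ ∧ ∀ t ∈ Finset.Icc 2 T, δ ≤ β t - β (t - 1)

/-- Convergence in probability of `X_N`, defined on `(Ω_N, P_N)`, to the constant `c`. -/
def TendstoInProbability {Ω : ℕ → Type*} [∀ N, MeasurableSpace (Ω N)]
    (P : ∀ N, Measure (Ω N)) (X : ∀ N, Ω N → ℝ) (c : ℝ) : Prop :=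
  ∀ ε : ℝ, 0 < ε → Tendsto (fun N => P N {ω | ε ≤ |X N ω - c|}) atTop (𝓝 0)

end

end PersistentSampling

namespace PersistentSampling

/-! Two statements are proved jointly by strong induction on `t`: the estimate `zHat` at `t` tends
to `normConst`, and the empirical measure of generation `t` tends to `target` on every measurable
set, both in probability. Convergence in probability is encoded as convergence along the filter
`inProbability`, so that the ordinary calculus of limits applies.

For the estimate, suppose first that the weights contain the exact constants. Their denominator is
then the density, with respect to the prior, of the mixture of the earlier targets, so reweighting
that mixture returns `L ^ β t` times the prior (`mixture_integral_weightAt`). Replacing exact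
constants by estimates costs little, uniformly in the point: the term `r = 1` keeps the denominator
at least `1 / (t - 1)` (`abs_weightAt_sub_le`).

For the empirical measure, both resampling and mutation are conditionally independent draws, so an
average of indicators differs from its conditional mean by a term of variance at most `1 / N`
(`tendsto_average_sub_average`). The conditional mean after resampling is a ratio of weighted
averages and tends to `p_t(B)`. After mutation it is the average of `K_t(·, B)` over the resampled
particles, with limit `∫ K_t(·, B) dp_t = p_t(B)`, since ergodicity forces `p_t` to be invariant
(`integral_kernel_target`). -/

/-! ### Convergence in probability as convergence along a filter -/

/-- The filter of the events, depending on `N`, whose probability tends to `1`. -/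
def inProbability {Ω : ℕ → Type*} [∀ N, MeasurableSpace (Ω N)] (P : ∀ N, Measure (Ω N)) :
    Filter (Σ N, Ω N) where
  sets := {S | Tendsto (fun N => P N {ω | (⟨N, ω⟩ : Σ N, Ω N) ∉ S}) atTop (𝓝 0)}
  univ_sets := by simp
  sets_of_superset {S S'} hS h :=
    tendsto_of_tendsto_of_tendsto_of_le_of_le tendsto_const_nhds hS (fun _ => zero_le)
      fun N => measure_mono fun ω hω hω' => hω (h hω')
  inter_sets {S S'} hS hS' := by
    have h := Tendsto.add (Set.mem_ofPred_eq ▸ hS) (Set.mem_ofPred_eq ▸ hS')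
    rw [add_zero] at h
    refine tendsto_of_tendsto_of_tendsto_of_le_of_le tendsto_const_nhds h (fun _ => zero_le)
      fun N => le_trans (measure_mono fun ω hω => ?_) (measure_union_le _ _)
    by_contra hc
    simp only [Set.mem_union, Set.mem_ofPred_eq, not_or, not_not] at hc
    exact hω hc

theorem eventually_inProbability {Ω : ℕ → Type*} [∀ N, MeasurableSpace (Ω N)]
    {P : ∀ N, Measure (Ω N)} {q : (Σ N, Ω N) → Prop} :
    (∀ᶠ p in inProbability P, q p) ↔ Tendsto (fun N => P N {ω | ¬ q ⟨N, ω⟩}) atTop (𝓝 0) :=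
  Iff.rfl

theorem tendstoInProbability_iff {Ω : ℕ → Type*} [∀ N, MeasurableSpace (Ω N)]
    {P : ∀ N, Measure (Ω N)} {X : ∀ N, Ω N → ℝ} {c : ℝ} :
    TendstoInProbability P X c ↔ Tendsto (fun p => X p.1 p.2) (inProbability P) (𝓝 c) := by
  simp only [Metric.tendsto_nhds, eventually_inProbability, TendstoInProbability, Real.dist_eq,
    not_lt]

theorem tendsto_fst_inProbability {Ω : ℕ → Type*} [∀ N, MeasurableSpace (Ω N)]
    (P : ∀ N, Measure (Ω N)) : Tendsto Sigma.fst (inProbability P) atTop := by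
  refine tendsto_atTop.2 fun n => eventually_inProbability.2 ?_
  refine tendsto_const_nhds.congr' ?_
  filter_upwards [eventually_ge_atTop n] with N hN
  simp [hN]

/-! ### Setwise convergence of measures -/

/-- Round `g` down to the grid `ε ℤ`; boundedness leaves finitely many levels. -/
theorem exists_measurable_fibers_approx {Θ : Type*} [MeasurableSpace Θ] {g : Θ → ℝ}
    (hg : Measurable g) {C : ℝ} (hC : ∀ x, |g x| ≤ C) {ε : ℝ} (hε : 0 < ε) :
    ∃ (S : Finset ℤ) (B : ℤ → Set Θ), (∀ k, MeasurableSet (B k)) ∧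
      ∀ x, |g x - ∑ k ∈ S, (k * ε) * (B k).indicator (fun _ => (1 : ℝ)) x| ≤ ε := by
  refine ⟨Finset.Icc ⌊-C / ε⌋ ⌊C / ε⌋, fun k => {x | ⌊g x / ε⌋ = k}, fun k => ?_, fun x => ?_⟩
  · exact (Int.measurable_floor.comp (hg.div_const ε)) (measurableSet_singleton k)
  · have hx := abs_le.1 (hC x)
    rw [Finset.sum_eq_single_of_mem ⌊g x / ε⌋]
    · simp only [Set.indicator, Set.mem_ofPred_eq, if_true, mul_one]
      have h1 := Int.floor_le (g x / ε)
      have h2 := Int.lt_floor_add_one (g x / ε)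
      rw [le_div_iff₀ hε] at h1
      rw [div_lt_iff₀ hε] at h2
      rw [abs_le]; constructor <;> nlinarith
    · rw [Finset.mem_Icc]
      constructor <;> apply Int.floor_le_floor <;> gcongr <;> linarith
    · intro k _ hk
      simp [Set.indicator, hk.symm]

/-- Setwise convergence handles simple functions, and these approximate `g` uniformly. Mass at most
one, rather than exactly one, admits the empirical measure of zero particles. -/
theorem tendsto_integral_of_tendsto_measureReal {α Θ : Type*} [MeasurableSpace Θ] {l : Filter α}
    {μ : α → Measure Θ} (hμ : ∀ a, μ a Set.univ ≤ 1) {p : Measure Θ} (hp : p Set.univ ≤ 1)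
    (h : ∀ B, MeasurableSet B → Tendsto (fun a => (μ a).real B) l (𝓝 (p.real B)))
    {g : Θ → ℝ} (hg : Measurable g) {C : ℝ} (hC : ∀ x, |g x| ≤ C) :
    Tendsto (fun a => ∫ x, g x ∂μ a) l (𝓝 (∫ x, g x ∂p)) := by
  rw [Metric.tendsto_nhds]
  intro ε hε
  obtain ⟨S, B, hB, hgB⟩ := exists_measurable_fibers_approx hg hC (show 0 < ε / 4 by positivity)
  set s : Θ → ℝ := fun x => ∑ k ∈ S, (k * (ε / 4)) * (B k).indicator (fun _ => (1 : ℝ)) x with hs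
  have key : ∀ ν : Measure Θ, ν Set.univ ≤ 1 →
      |∫ x, g x ∂ν - ∑ k ∈ S, (k * (ε / 4)) * ν.real (B k)| ≤ ε / 4 := by
    intro ν hν
    have : IsFiniteMeasure ν := ⟨hν.trans_lt ENNReal.one_lt_top⟩
    have hi : ∀ k ∈ S, Integrable
        (fun x => (k * (ε / 4)) * (B k).indicator (fun _ => (1 : ℝ)) x) ν := fun k _ =>
      ((integrable_const (1 : ℝ)).indicator (hB k)).const_mul _
    have hsum : ∫ x, s x ∂ν = ∑ k ∈ S, (k * (ε / 4)) * ν.real (B k) := by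
      rw [hs, integral_finsetSum _ hi]
      refine Finset.sum_congr rfl fun k _ => ?_
      rw [integral_const_mul, integral_indicator_const _ (hB k)]
      simp
    have hgi : Integrable g ν := Integrable.of_bound hg.aestronglyMeasurable C
      (Eventually.of_forall fun x => by simpa using hC x)
    rw [← hsum, ← integral_sub hgi (integrable_finsetSum _ hi)]
    refine (norm_integral_le_of_norm_le_const 
      (Eventually.of_forall fun x => (Real.norm_eq_abs _).trans_le (hgB x))).trans ?_
    have : ν.real Set.univ ≤ 1 := by
      simpa [Measure.real] using ENNReal.toReal_mono ENNReal.one_ne_top hν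
    nlinarith
  have hlim : Tendsto (fun a => ∑ k ∈ S, (k * (ε / 4)) * (μ a).real (B k)) l
      (𝓝 (∑ k ∈ S, (k * (ε / 4)) * p.real (B k))) :=
    tendsto_finsetSum _ fun k _ => (h (B k) (hB k)).const_mul _
  filter_upwards [Metric.tendsto_nhds.1 hlim (ε / 4) (by positivity)] with a ha
  rw [Real.dist_eq] at ha ⊢
  have h1 := abs_le.1 (key (μ a) (hμ a))
  have h2 := abs_le.1 (key p hp)
  have h3 := abs_lt.1 ha
  rw [abs_lt]; constructor <;> linarith

/-! ### Empirical averages -/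

/-- The average of `g` over the points `x i`, `i < N`. -/
noncomputable def average {Θ : Type*} {N : ℕ} (x : Fin N → Θ) (g : Θ → ℝ) : ℝ :=
  1 / (N : ℝ) * ∑ i, g (x i)

theorem average_eq_integral {Θ : Type*} [MeasurableSpace Θ] {N : ℕ} (x : Fin N → Θ) {g : Θ → ℝ}
    (hg : Measurable g) :
    average x g = ∫ y, g y ∂((N : ℝ≥0∞)⁻¹ • ∑ i, Measure.dirac (x i)) := by
  rw [integral_smul_measure, integral_finsetSum_measure, average]
  · simp [integral_dirac' _ _ hg.stronglyMeasurable]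
  · intro i _
    exact integrable_dirac' hg.stronglyMeasurable (by simp)

theorem tendsto_average {α Θ : Type*} [MeasurableSpace Θ] {l : Filter α}
    {N : α → ℕ} {x : ∀ a, Fin (N a) → Θ} {p : Measure Θ} [IsProbabilityMeasure p]
    (h : ∀ B, MeasurableSet B →
      Tendsto (fun a => average (x a) (B.indicator fun _ => 1)) l (𝓝 (p.real B)))
    {g : Θ → ℝ} (hg : Measurable g) {C : ℝ} (hC : ∀ x, |g x| ≤ C) :
    Tendsto (fun a => average (x a) g) l (𝓝 (∫ y, g y ∂p)) := by
  simp only [average_eq_integral _ hg]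
  refine tendsto_integral_of_tendsto_measureReal (fun a => ?_) (by simp) (fun B hB => ?_) hg hC
  · simp only [Measure.smul_apply, Measure.finsetSum_apply, measure_univ, smul_eq_mul,
      Finset.sum_const, Finset.card_univ, Fintype.card_fin, nsmul_eq_mul, mul_one]
    exact ENNReal.inv_mul_le_one _
  · refine (h B hB).congr fun a => ?_
    rw [average_eq_integral _ (measurable_const.indicator hB), integral_indicator_const _ hB]
    simp

/-! ### A conditional law of large numbers -/

/-- Pulling out conditional expectations makes all cross terms equal to the integral of `P[f | m] *
P[g | m]`. `F` and `G` are only almost everywhere versions, so explicit formulas can be inserted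
without proving them `m`-measurable. -/
theorem integral_sub_mul_sub_eq_zero {Ω : Type*} {m m₀ : MeasurableSpace Ω} {P : Measure Ω}
    [IsProbabilityMeasure P] (hm : m ≤ m₀) {f g F G : Ω → ℝ}
    (hf : Measurable f) (hg : Measurable g) (hf1 : ∀ ω, |f ω| ≤ 1) (hg1 : ∀ ω, |g ω| ≤ 1)
    (hF : P[f | m] =ᵐ[P] F) (hG : P[g | m] =ᵐ[P] G) (hFG : P[f * g | m] =ᵐ[P] F * G) :
    ∫ ω, (f ω - F ω) * (g ω - G ω) ∂P = 0 := by
  have hfi : Integrable f P := Integrable.of_bound hf.aestronglyMeasurable 1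
    (Eventually.of_forall fun x => by simpa using hf1 x)
  have hgi : Integrable g P := Integrable.of_bound hg.aestronglyMeasurable 1
    (Eventually.of_forall fun x => by simpa using hg1 x)
  have hfg : Integrable (f * g) P := hfi.mul_bdd hg.aestronglyMeasurable
    (Eventually.of_forall fun x => by simpa using hg1 x)
  have hF1 : ∀ᵐ ω ∂P, |P[f | m] ω| ≤ 1 :=
    ae_bdd_abs_condExp_of_ae_bdd_abs (R := 1) (Eventually.of_forall fun x => by simpa using hf1 x)
  have hG1 : ∀ᵐ ω ∂P, |P[g | m] ω| ≤ 1 :=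
    ae_bdd_abs_condExp_of_ae_bdd_abs (R := 1) (Eventually.of_forall fun x => by simpa using hg1 x)
  have hFs := (stronglyMeasurable_condExp (m := m) (μ := P) (f := f))
  have hGs := (stronglyMeasurable_condExp (m := m) (μ := P) (f := g))
  have ifG : Integrable (f * P[g | m]) P :=
    hfi.mul_bdd (hGs.mono hm).aestronglyMeasurable hG1
  have iFg : Integrable (P[f | m] * g) P :=
    hgi.bdd_mul (hFs.mono hm).aestronglyMeasurable hF1
  have iFG : Integrable (P[f | m] * P[g | m]) P :=
    integrable_condExp.mul_bdd (hGs.mono hm).aestronglyMeasurable hG1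
  have e1 : ∫ ω, (f * P[g | m]) ω ∂P = ∫ ω, (P[f | m] * P[g | m]) ω ∂P := by
    rw [← integral_condExp hm]
    exact integral_congr_ae (condExp_mul_of_stronglyMeasurable_right hGs ifG hfi)
  have e2 : ∫ ω, (P[f | m] * g) ω ∂P = ∫ ω, (P[f | m] * P[g | m]) ω ∂P := by
    rw [← integral_condExp hm]
    exact integral_congr_ae (condExp_mul_of_stronglyMeasurable_left hFs iFg hgi)
  have e3 : ∫ ω, (f * g) ω ∂P = ∫ ω, (P[f | m] * P[g | m]) ω ∂P := by
    rw [← integral_condExp hm]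
    exact integral_congr_ae (hFG.trans (hF.mul hG).symm)
  have e : ∫ ω, (f ω - F ω) * (g ω - G ω) ∂P =
      ∫ ω, (f * g - f * P[g | m] - P[f | m] * g + P[f | m] * P[g | m]) ω ∂P := by
    refine integral_congr_ae ?_
    filter_upwards [hF, hG] with ω h1 h2
    simp only [Pi.add_apply, Pi.sub_apply, Pi.mul_apply, h1, h2]
    ring
  rw [e, integral_add' ((hfg.sub ifG).sub iFg) iFG, integral_sub' (hfg.sub ifG) iFg,
    integral_sub' hfg ifG, e1, e2, e3]
  ring

/-- Off-diagonal terms of the expanded square vanish by conditional independence; each of the `N`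
diagonal terms is at most one. -/
theorem integral_sq_average_sub_le {Ω : Type*} {m m₀ : MeasurableSpace Ω} {P : Measure Ω}
    [IsProbabilityMeasure P] (hm : m ≤ m₀) {N : ℕ} {f F : Fin N → Ω → ℝ}
    (hf : ∀ i, Measurable (f i)) (hf0 : ∀ i ω, 0 ≤ f i ω) (hf1 : ∀ i ω, f i ω ≤ 1)
    (hF : ∀ i, P[f i | m] =ᵐ[P] F i)
    (hFF : ∀ i j, i ≠ j → P[f i * f j | m] =ᵐ[P] F i * F j) :
    Integrable (fun ω => (∑ i, (f i ω - F i ω)) ^ 2) P ∧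
      ∫ ω, (∑ i, (f i ω - F i ω)) ^ 2 ∂P ≤ N := by
  have hfa : ∀ i ω, |f i ω| ≤ 1 := fun i ω => abs_le.2 ⟨by linarith [hf0 i ω], hf1 i ω⟩
  have hfi : ∀ i, Integrable (f i) P := fun i =>
    Integrable.of_bound (hf i).aestronglyMeasurable 1
      (Eventually.of_forall fun x => by simpa using hfa i x)
  have hFm : ∀ i, AEStronglyMeasurable (F i) P := fun i =>
    (integrable_condExp.aestronglyMeasurable).congr (hF i)
  have hF01 : ∀ i, ∀ᵐ ω ∂P, 0 ≤ F i ω ∧ F i ω ≤ 1 := by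
    intro i
    have h0 : 0 ≤ᵐ[P] P[f i | m] := condExp_nonneg (Eventually.of_forall (hf0 i))
    have h1 : P[f i | m] ≤ᵐ[P] P[fun _ => (1 : ℝ) | m] :=
      condExp_mono (hfi i) (integrable_const _) (Eventually.of_forall (hf1 i))
    rw [condExp_const hm] at h1
    filter_upwards [h0, h1, hF i] with ω a b c
    exact ⟨c ▸ a, c ▸ b⟩
  have hD : ∀ i, ∀ᵐ ω ∂P, |f i ω - F i ω| ≤ 1 := by
    intro i
    filter_upwards [hF01 i] with ω h
    rw [abs_le]
    constructor <;> linarith [hf0 i ω, hf1 i ω, h.1, h.2]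
  have hDm : ∀ i, AEStronglyMeasurable (fun ω => f i ω - F i ω) P := fun i =>
    (hf i).aestronglyMeasurable.sub (hFm i)
  have hint : ∀ i j, Integrable (fun ω => (f i ω - F i ω) * (f j ω - F j ω)) P := by
    intro i j
    refine Integrable.of_bound ((hDm i).mul (hDm j)) 1 ?_
    filter_upwards [hD i, hD j] with ω h1 h2
    rw [norm_mul]
    exact mul_le_one₀ h1 (norm_nonneg _) h2
  have hexp : (fun ω => (∑ i, (f i ω - F i ω)) ^ 2) =
      fun ω => ∑ i, ∑ j, (f i ω - F i ω) * (f j ω - F j ω) := by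
    funext ω
    rw [sq, Finset.sum_mul_sum]
  rw [hexp]
  refine ⟨integrable_finsetSum _ fun i _ => integrable_finsetSum _ fun j _ => hint i j, ?_⟩
  rw [integral_finsetSum _ fun i _ => integrable_finsetSum _ fun j _ => hint i j]
  have hrow : ∀ i ∈ (Finset.univ : Finset (Fin N)),
      ∫ ω, ∑ j, (f i ω - F i ω) * (f j ω - F j ω) ∂P ≤ 1 := by
    intro i _
    rw [integral_finsetSum _ fun j _ => hint i j, Finset.sum_eq_single i]
    · refine (integral_mono_ae (hint i i) (integrable_const (1 : ℝ)) ?_).trans (by simp)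
      filter_upwards [hD i] with ω h
      have := abs_le.1 h
      nlinarith
    · intro j _ hj
      exact integral_sub_mul_sub_eq_zero hm (hf i) (hf j) (hfa i) (hfa j) (hF i) (hF j)
        (hFF i j hj.symm)
    · simp
  refine (Finset.sum_le_card_nsmul _ _ 1 hrow).trans (by simp)

theorem measure_le_average_sub_le {Ω : Type*} {m m₀ : MeasurableSpace Ω} {P : Measure Ω}
    [IsProbabilityMeasure P] (hm : m ≤ m₀) {N : ℕ} {f F : Fin N → Ω → ℝ}
    (hf : ∀ i, Measurable (f i)) (hf0 : ∀ i ω, 0 ≤ f i ω) (hf1 : ∀ i ω, f i ω ≤ 1)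
    (hF : ∀ i, P[f i | m] =ᵐ[P] F i)
    (hFF : ∀ i j, i ≠ j → P[f i * f j | m] =ᵐ[P] F i * F j) {ε : ℝ} (hε : 0 < ε) :
    P {ω | ε ≤ |1 / (N : ℝ) * ∑ i, f i ω - 1 / (N : ℝ) * ∑ i, F i ω|} ≤
      ENNReal.ofReal (1 / (ε ^ 2 * N)) := by
  -- With no particles both averages are `0`, and the event is empty.
  rcases Nat.eq_zero_or_pos N with rfl | hN
  · simp [not_le.2 hε]
  obtain ⟨hi, hle⟩ := integral_sq_average_sub_le hm hf hf0 hf1 hF hFF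
  have hN' : (0 : ℝ) < N := by exact_mod_cast hN
  have hM := mul_meas_ge_le_integral_of_nonneg
    (Eventually.of_forall fun ω => sq_nonneg (∑ i, (f i ω - F i ω))) hi ((ε * N) ^ 2)
  have hset : {ω | ε ≤ |1 / (N : ℝ) * ∑ i, f i ω - 1 / (N : ℝ) * ∑ i, F i ω|} =
      {ω | (ε * N) ^ 2 ≤ (∑ i, (f i ω - F i ω)) ^ 2} := by
    ext ω
    simp only [Set.mem_ofPred_eq]
    rw [sq_le_sq, abs_of_pos (mul_pos hε hN'), Finset.sum_sub_distrib, ← mul_sub, abs_mul,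
      abs_of_pos (by positivity), one_div, ← div_eq_inv_mul, le_div_iff₀ hN']
  rw [hset, ← ENNReal.ofReal_toReal (measure_ne_top P _)]
  refine ENNReal.ofReal_le_ofReal ?_
  rw [le_div_iff₀ (by positivity)]
  have h := hM.trans hle
  change (ε * N) ^ 2 * (P _).toReal ≤ N at h
  refine le_of_mul_le_mul_right ?_ hN'
  linarith [mul_pow ε (N : ℝ) 2]

/-- Taking the whole space in the coordinates outside `S` yields the joint conditional law on `S`.
Singletons and pairs suffice for the variance bound. -/
theorem condExp_indicator_mem {Ω Θ : Type*} [MeasurableSpace Θ] {m m₀ : MeasurableSpace Ω}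
    {P : Measure Ω} {N : ℕ} {Y : Fin N → Ω → Θ} {Q : Fin N → Ω → Set Θ → ℝ}
    (hQ : ∀ i ω, Q i ω Set.univ = 1)
    (hrect : ∀ B : Fin N → Set Θ, (∀ i, MeasurableSet (B i)) →
      P[({ω | ∀ i, Y i ω ∈ B i}).indicator (fun _ => (1 : ℝ)) | m] =ᵐ[P]
        fun ω => ∏ i, Q i ω (B i))
    {B : Set Θ} (hB : MeasurableSet B) (S : Finset (Fin N)) :
    P[fun ω => ∏ i ∈ S, B.indicator (fun _ => (1 : ℝ)) (Y i ω) | m] =ᵐ[P]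
      fun ω => ∏ i ∈ S, Q i ω B := by
  classical
  have h := hrect (fun i => if i ∈ S then B else Set.univ) fun i => by
    split_ifs <;> [exact hB; exact MeasurableSet.univ]
  convert h using 2
  · funext ω
    by_cases hω : ∀ i ∈ S, Y i ω ∈ B
    · rw [Finset.prod_eq_one fun i hi => by simp [hω i hi], Set.indicator_of_mem]
      intro i
      split_ifs with hi <;> [exact hω i hi; trivial]
    · have hω' := hω
      push Not at hω'
      obtain ⟨i, hi, hiB⟩ := hω'
      rw [Finset.prod_eq_zero hi (by simp [hiB]), Set.indicator_of_notMem]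
      intro hc
      have := hc i
      rw [if_pos hi] at this
      exact hiB this
  · have : ∀ ω i, Q i ω (if i ∈ S then B else Set.univ) = if i ∈ S then Q i ω B else 1 := by
      intro ω i
      split_ifs <;> [rfl; exact hQ _ _]
    simp only [this, Finset.prod_ite_mem, Finset.univ_inter]

/-- Conditional law of large numbers by Chebyshev. The bound `1 / (ε ^ 2 * N)` does not involve the
conditioning, so the σ-algebra may change with `N` and the conditional means need not converge. -/
theorem tendsto_average_sub_average {Ω : ℕ → Type*} {Θ : Type*} [m₀ : ∀ N, MeasurableSpace (Ω N)]
    [MeasurableSpace Θ] {P : ∀ N, Measure (Ω N)} [∀ N, IsProbabilityMeasure (P N)]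
    {Y : ∀ N, Fin N → Ω N → Θ} (hY : ∀ N i, Measurable (Y N i))
    {Q : ∀ N, Fin N → Ω N → Set Θ → ℝ} (hQ : ∀ N i ω, Q N i ω Set.univ = 1)
    (hrect : ∀ N, ∃ m ≤ m₀ N, ∀ B : Fin N → Set Θ, (∀ i, MeasurableSet (B i)) →
      (P N)[({ω | ∀ i, Y N i ω ∈ B i}).indicator (fun _ => (1 : ℝ)) | m] =ᵐ[P N]
        fun ω => ∏ i, Q N i ω (B i))
    {B : Set Θ} (hB : MeasurableSet B) :
    Tendsto (fun p : Σ N, Ω N => average (fun i => Y p.1 i p.2) (B.indicator fun _ => 1) -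
      1 / (p.1 : ℝ) * ∑ i, Q p.1 i p.2 B) (inProbability P) (𝓝 0) := by
  refine (tendstoInProbability_iff (X := fun N ω =>
    average (fun i => Y N i ω) (B.indicator fun _ => 1) - 1 / (N : ℝ) * ∑ i, Q N i ω B)).1 ?_
  intro ε hε
  have hlim : Tendsto (fun N : ℕ => ENNReal.ofReal (1 / (ε ^ 2 * N))) atTop (𝓝 0) := by
    rw [← ENNReal.ofReal_zero]
    refine ENNReal.tendsto_ofReal ?_
    exact (tendsto_natCast_atTop_atTop.const_mul_atTop (by positivity)).const_div_atTop 1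
  refine tendsto_of_tendsto_of_tendsto_of_le_of_le tendsto_const_nhds hlim (fun _ => zero_le)
    fun N => ?_
  simp only [sub_zero]
  have hYB : ∀ i, Measurable fun ω => B.indicator (fun _ => (1 : ℝ)) (Y N i ω) :=
    fun i => (measurable_const.indicator hB).comp (hY N i)
  obtain ⟨m, hm, hrect⟩ := hrect N
  refine measure_le_average_sub_le hm
    (f := fun i ω => B.indicator (fun _ => (1 : ℝ)) (Y N i ω)) (F := fun i ω => Q N i ω B)
    hYB
    (fun i ω => Set.indicator_nonneg (fun _ _ => zero_le_one) _)
    (fun i ω => Set.indicator_le_self' (fun _ _ => zero_le_one) _) (fun i => ?_)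
    (fun i j hij => ?_) hε
  · simpa using condExp_indicator_mem (hQ N) hrect hB {i}
  · have := condExp_indicator_mem (hQ N) hrect hB {i, j}
    simp only [Finset.prod_pair hij] at this
    exact this

/-! ### Consequences of the conditions -/

/-- At a zero of `L` the ratio with exponents `β 1 = 0` and `β T = 1` would be `1 / 0 = ∞`. -/
theorem LikelihoodRatioBounded.pos {Θ : Type*} {L : Θ → ℝ≥0} {β : ℕ → ℝ} {T : ℕ}
    (h : LikelihoodRatioBounded L β T) (hβ_one : β 1 = 0) (hβ_T : β T = 1) (hT : 1 ≤ T) (θ : Θ) :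
    0 < L θ := by
  obtain ⟨M, hM⟩ := h 1 (by simp [hT]) T (by simp [hT])
  rw [pos_iff_ne_zero]
  intro h0
  have := (le_iSup _ θ).trans hM
  simp [hβ_one, hβ_T, h0] at this

theorem LikelihoodRatioBounded.exists_bound {Θ : Type*} {L : Θ → ℝ≥0} {β : ℕ → ℝ} {T : ℕ}
    (h : LikelihoodRatioBounded L β T) (hβ_one : β 1 = 0) (hpos : ∀ θ, 0 < L θ) :
    ∃ M : ℝ, ∀ r ∈ Finset.Icc 1 T, ∀ θ, (L θ : ℝ) ^ β r ≤ M := by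
  have h1 : ∀ r ∈ Finset.Icc 1 T, ∃ M : ℝ≥0, ∀ θ, L θ ^ β r ≤ M := by
    intro r hr
    obtain ⟨M, hM⟩ := h r hr 1 (by simp at hr ⊢; omega)
    refine ⟨M, fun θ => ?_⟩
    have := (le_iSup _ θ).trans hM
    rw [hβ_one, ENNReal.rpow_zero, div_one, ← ENNReal.coe_rpow_of_ne_zero (hpos θ).ne'] at this
    exact_mod_cast this
  choose! M hM using h1
  refine ⟨((∑ r ∈ Finset.Icc 1 T, M r : ℝ≥0) : ℝ), fun r hr θ => ?_⟩
  rw [← NNReal.coe_rpow]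
  exact_mod_cast (hM r hr θ).trans (Finset.single_le_sum (f := M) (fun _ _ => zero_le) hr)

theorem measurable_rpow {Θ : Type*} [MeasurableSpace Θ] {L : Θ → ℝ≥0} (hL : Measurable L)
    (b : ℝ) : Measurable fun θ => (L θ : ℝ) ^ b :=
  (measurable_coe_nnreal_real.comp hL).pow_const b

/-! ### The targets -/

theorem integral_target {Θ : Type*} [MeasurableSpace Θ] (prior : Measure Θ) {L : Θ → ℝ≥0}
    (hL : Measurable L) (β : ℕ → ℝ) {t : ℕ} (hZ : 0 < normConst prior L β t) (g : Θ → ℝ) :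
    ∫ θ, g θ ∂(target prior L β t) =
      (normConst prior L β t)⁻¹ * ∫ θ, (L θ : ℝ) ^ β t * g θ ∂prior := by
  rw [target, integral_withDensity_eq_integral_toReal_smul
    ((measurable_rpow hL _).div_const _).ennreal_ofReal
    (Eventually.of_forall fun _ => ENNReal.ofReal_lt_top), ← integral_const_mul]
  refine integral_congr_ae (Eventually.of_forall fun θ => ?_)
  have : 0 ≤ (L θ : ℝ) ^ β t / normConst prior L β t := by positivity
  simp only [ENNReal.toReal_ofReal this, smul_eq_mul]
  ring

theorem isProbabilityMeasure_target {Θ : Type*} [MeasurableSpace Θ] (prior : Measure Θ)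
    {L : Θ → ℝ≥0} {β : ℕ → ℝ} {t : ℕ} (hZ : 0 < normConst prior L β t) :
    IsProbabilityMeasure (target prior L β t) := by
  constructor
  have hi : Integrable (fun θ => (L θ : ℝ) ^ β t) prior := by
    -- A non-integrable function has integral `0` by convention, which contradicts `hZ`.
    by_contra h
    rw [normConst, integral_undef h] at hZ
    exact lt_irrefl _ hZ
  rw [target, withDensity_apply _ MeasurableSet.univ, Measure.restrict_univ,
    ← ofReal_integral_eq_lintegral_ofReal (hi.div_const _)
      (Eventually.of_forall fun θ => by positivity), integral_div]
  change ENNReal.ofReal (normConst prior L β t / normConst prior L β t) = 1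
  rw [div_self hZ.ne', ENNReal.ofReal_one]

theorem measureReal_target {Θ : Type*} [MeasurableSpace Θ] (prior : Measure Θ)
    {L : Θ → ℝ≥0} (hL : Measurable L) {β : ℕ → ℝ} {t : ℕ} (hZ : 0 < normConst prior L β t)
    {B : Set Θ} (hB : MeasurableSet B) :
    (target prior L β t).real B = (normConst prior L β t)⁻¹ *
      ∫ θ, (L θ : ℝ) ^ β t * B.indicator (fun _ => (1 : ℝ)) θ ∂prior := by
  rw [← integral_target prior hL β hZ, integral_indicator_const _ hB]
  simp

theorem target_one {Θ : Type*} [MeasurableSpace Θ] (prior : Measure Θ) [IsProbabilityMeasure prior]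
    (L : Θ → ℝ≥0) {β : ℕ → ℝ} (hβ_one : β 1 = 0) : target prior L β 1 = prior := by
  simp [target, normConst, hβ_one]

/-! ### Invariance of an ergodic target -/

theorem abs_measureReal_sub_le_tvDist {Θ : Type*} [MeasurableSpace Θ] (μ ν : Measure Θ)
    [IsProbabilityMeasure μ] [IsProbabilityMeasure ν] {B : Set Θ} (hB : MeasurableSet B) :
    |μ.real B - ν.real B| ≤ tvDist μ ν := by
  refine le_ciSup (f := fun A : {A : Set Θ // MeasurableSet A} => |μ.real A - ν.real A|)
    ⟨1, ?_⟩ ⟨B, hB⟩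
  rintro _ ⟨A, rfl⟩
  have h1 : μ.real A ≤ 1 := measureReal_le_one
  have h2 : ν.real A ≤ 1 := measureReal_le_one
  have h3 : 0 ≤ μ.real A := measureReal_nonneg
  have h4 : 0 ≤ ν.real A := measureReal_nonneg
  exact abs_le.2 ⟨by linarith, by linarith⟩

instance isMarkovKernel_pow {Θ : Type*} [MeasurableSpace Θ] (κ : Kernel Θ Θ) [IsMarkovKernel κ]
    (n : ℕ) : IsMarkovKernel (κ ^ n) := by
  induction n with
  | zero => rw [pow_zero]; exact inferInstanceAs (IsMarkovKernel Kernel.id)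
  | succ n ih => rw [pow_succ']; exact inferInstanceAs (IsMarkovKernel (κ ∘ₖ (κ ^ n)))

/-- Let `n` tend to infinity in `κ ^ (n + 1) (θ₀, B) = ∫ κ(·, B) dκ ^ n (θ₀)`. One starting point
and setwise convergence are enough. -/
theorem integral_measureReal_eq_of_tendsto {Θ : Type*} [MeasurableSpace Θ] (κ : Kernel Θ Θ)
    [IsMarkovKernel κ] {p : Measure Θ} [IsProbabilityMeasure p] (θ₀ : Θ)
    (h : ∀ B, MeasurableSet B →
      Tendsto (fun n => ((κ ^ n) θ₀).real B) atTop (𝓝 (p.real B)))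
    {B : Set Θ} (hB : MeasurableSet B) : ∫ θ, (κ θ).real B ∂p = p.real B := by
  have hmeas : Measurable fun θ => (κ θ).real B := (κ.measurable_coe hB).ennreal_toReal
  have h1 := tendsto_integral_of_tendsto_measureReal (μ := fun n => (κ ^ n) θ₀)
    (fun n => by simp) (by simp) h hmeas (C := 1) fun θ => by
      rw [abs_of_nonneg measureReal_nonneg]; exact measureReal_le_one
  refine tendsto_nhds_unique h1 (((h B hB).comp (tendsto_add_atTop_nat 1)).congr fun n => ?_)
  have hstep : ((κ ^ (n + 1)) θ₀) B = ∫⁻ θ, κ θ B ∂((κ ^ n) θ₀) := by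
    rw [pow_succ']
    exact Kernel.comp_apply' κ (κ ^ n) θ₀ hB
  simp only [Function.comp_apply, Measure.real]
  rw [hstep, integral_toReal (κ.measurable_coe hB).aemeasurable
    (Eventually.of_forall fun θ => measure_lt_top _ _)]

theorem integral_kernel_target {Θ : Type*} [MeasurableSpace Θ] {prior : Measure Θ}
    [IsProbabilityMeasure prior] {L : Θ → ℝ≥0} {β : ℕ → ℝ} {K : ℕ → Kernel Θ Θ}
    [∀ t, IsMarkovKernel (K t)] {T : ℕ} (h : KernelsGeometricallyErgodic prior L β K T)
    {t : ℕ} (ht : t ∈ Finset.Icc 1 T) (hZ : 0 < normConst prior L β t)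
    {B : Set Θ} (hB : MeasurableSet B) :
    ∫ θ, (K t θ).real B ∂(target prior L β t) = (target prior L β t).real B := by
  obtain ⟨C, ρ, hρ0, hρ1, hK⟩ := h t ht
  have := isProbabilityMeasure_target prior hZ
  obtain ⟨θ₀⟩ := prior.nonempty_of_neZero
  refine integral_measureReal_eq_of_tendsto (K t) θ₀ (fun A hA => ?_) hB
  rw [tendsto_iff_dist_tendsto_zero]
  have hlim : Tendsto (fun n : ℕ => C * ρ ^ n) atTop (𝓝 0) := by
    simpa using (tendsto_pow_atTop_nhds_zero_of_lt_one hρ0.le hρ1).const_mul C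
  refine squeeze_zero' (Eventually.of_forall fun _ => dist_nonneg) ?_ hlim
  filter_upwards [eventually_ge_atTop 1] with n hn
  exact (abs_measureReal_sub_le_tvDist _ _ hA).trans (hK n hn θ₀)

/-! ### Weights -/

theorem weight_nonneg_of {Θ : Type*} (L : Θ → ℝ≥0) (β : ℕ → ℝ) {N : ℕ} (x : ℕ → Fin N → Θ)
    {t : ℕ} (ht : 2 ≤ t) (h : ∀ r ∈ Finset.Ico 1 t, 0 ≤ zHat L β x r) (s : ℕ) (i : Fin N) :
    0 ≤ weight L β x t s i := by
  have ht' : (0 : ℝ) < (t : ℝ) - 1 := by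
    have : (2 : ℝ) ≤ t := by exact_mod_cast ht
    linarith
  refine div_nonneg (by positivity) (mul_nonneg (by positivity) ?_)
  exact Finset.sum_nonneg fun r hr => mul_nonneg (by positivity) (inv_nonneg.2 (h r hr))

theorem zHat_nonneg {Θ : Type*} (L : Θ → ℝ≥0) (β : ℕ → ℝ) {N : ℕ} (x : ℕ → Fin N → Θ) (t : ℕ) :
    0 ≤ zHat L β x t := by
  induction t using Nat.strong_induction_on with
  | _ t ih =>
    by_cases ht : t ≤ 1
    · rw [zHat, if_pos ht]; exact zero_le_one
    · have ht2 : 2 ≤ t := by omega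
      have ht' : (0 : ℝ) < (t : ℝ) - 1 := by
        have : (2 : ℝ) ≤ t := by exact_mod_cast ht2
        linarith
      rw [zHat_eq _ _ _ _ ht2]
      refine mul_nonneg (by positivity) (Finset.sum_nonneg fun s _ => ?_)
      refine mul_nonneg (by positivity) (Finset.sum_nonneg fun i _ => ?_)
      exact weight_nonneg_of L β x ht2 (fun r hr => ih r (Finset.mem_Ico.1 hr).2) s i

/-- The term `r = 1` equals one. This keeps the weights bounded and stable under perturbation of the
estimates. -/
theorem one_le_sum_rpow_mul_inv {Θ : Type*} (L : Θ → ℝ≥0) {β : ℕ → ℝ} (hβ_one : β 1 = 0)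
    {z : ℕ → ℝ} (hz1 : z 1 = 1) {t : ℕ} (hz : ∀ r ∈ Finset.Ico 1 t, 0 ≤ z r) (ht : 2 ≤ t) (θ : Θ) :
    1 ≤ ∑ r ∈ Finset.Ico 1 t, (L θ : ℝ) ^ β r * (z r)⁻¹ := by
  have := Finset.single_le_sum (f := fun r => (L θ : ℝ) ^ β r * (z r)⁻¹)
    (fun r hr => mul_nonneg (by positivity) (inv_nonneg.2 (hz r hr)))
    (Finset.mem_Ico.2 ⟨le_rfl, ht⟩ : 1 ∈ Finset.Ico 1 t)
  simpa [hβ_one, hz1] using this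

theorem weight_pos {Θ : Type*} {L : Θ → ℝ≥0} (hpos : ∀ θ, 0 < L θ) {β : ℕ → ℝ} (hβ_one : β 1 = 0)
    {N : ℕ} (x : ℕ → Fin N → Θ) {t : ℕ} (ht : 2 ≤ t) (s : ℕ) (i : Fin N) :
    0 < weight L β x t s i := by
  have ht' : (0 : ℝ) < (t : ℝ) - 1 := by
    have : (2 : ℝ) ≤ t := by exact_mod_cast ht
    linarith
  have := one_le_sum_rpow_mul_inv L hβ_one (zHat_one L β x) (fun r _ => zHat_nonneg L β x r) ht
    (x s i)
  have hp : (0 : ℝ) < L (x s i) := by exact_mod_cast hpos _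
  unfold weight
  positivity

theorem zHat_pos {Θ : Type*} {L : Θ → ℝ≥0} (hpos : ∀ θ, 0 < L θ) {β : ℕ → ℝ} (hβ_one : β 1 = 0)
    {N : ℕ} [NeZero N] (x : ℕ → Fin N → Θ) {t : ℕ} (ht : 2 ≤ t) : 0 < zHat L β x t := by
  have ht' : (0 : ℝ) < (t : ℝ) - 1 := by
    have : (2 : ℝ) ≤ t := by exact_mod_cast ht
    linarith
  have hN : (0 : ℝ) < N := by exact_mod_cast Nat.pos_of_neZero N
  rw [zHat_eq _ _ _ _ ht]
  refine mul_pos (by positivity) (Finset.sum_pos (fun s _ => ?_) ⟨1, by simp; omega⟩)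
  exact mul_pos (by positivity) (Finset.sum_pos (fun i _ => weight_pos hpos hβ_one x ht s i)
    Finset.univ_nonempty)

/-- The weight of the point `θ` at iteration `t`, when the estimates are replaced by `z`. -/
noncomputable def weightAt {Θ : Type*} (L : Θ → ℝ≥0) (β : ℕ → ℝ) (z : ℕ → ℝ) (t : ℕ) (θ : Θ) : ℝ :=
  (L θ : ℝ) ^ β t / (1 / ((t : ℝ) - 1) * ∑ r ∈ Finset.Ico 1 t, (L θ : ℝ) ^ β r * (z r)⁻¹)

theorem abs_div_sub_div_le {A M c D D' : ℝ} (hA0 : 0 ≤ A) (hA : A ≤ M) (hc : 0 < c) (hD : c ≤ D)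
    (hD' : c ≤ D') : |A / D - A / D'| ≤ M / c ^ 2 * |D - D'| := by
  have hDp := hc.trans_le hD
  have hDp' := hc.trans_le hD'
  have : A / D - A / D' = A / (D * D') * (D' - D) := by field_simp
  rw [this, abs_mul, abs_of_nonneg (by positivity), abs_sub_comm D']
  have hM := hA0.trans hA
  rw [sq]
  gcongr

/-- With `c = 1 / (t - 1)` below both denominators, the constant is `(M / c ^ 2) * c * M`.
Uniformity in `θ` matters because the particles and the estimates are dependent. -/
theorem abs_weightAt_sub_le {Θ : Type*} {L : Θ → ℝ≥0} {β : ℕ → ℝ} (hβ_one : β 1 = 0)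
    {t : ℕ} (ht : 2 ≤ t) {M : ℝ} (hM : ∀ r ∈ Finset.Icc 1 t, ∀ θ, (L θ : ℝ) ^ β r ≤ M)
    {z z' : ℕ → ℝ} (hz1 : z 1 = 1) (hz1' : z' 1 = 1)
    (hz : ∀ r ∈ Finset.Ico 1 t, 0 ≤ z r) (hz' : ∀ r ∈ Finset.Ico 1 t, 0 ≤ z' r) (θ : Θ) :
    |weightAt L β z t θ - weightAt L β z' t θ| ≤
      M ^ 2 * ((t : ℝ) - 1) * ∑ r ∈ Finset.Ico 1 t, |(z r)⁻¹ - (z' r)⁻¹| := by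
  have ht' : (0 : ℝ) < (t : ℝ) - 1 := by
    have : (2 : ℝ) ≤ t := by exact_mod_cast ht
    linarith
  have hM0 : 0 ≤ M := le_trans (by positivity) (hM t (by simp; omega) θ)
  have h1 := one_le_sum_rpow_mul_inv L hβ_one hz1 hz ht θ
  have h1' := one_le_sum_rpow_mul_inv L hβ_one hz1' hz' ht θ
  have hc : 0 < 1 / ((t : ℝ) - 1) := by positivity
  refine (abs_div_sub_div_le (by positivity) (hM t (by simp; omega) θ) hc
    (le_mul_of_one_le_right hc.le h1) (le_mul_of_one_le_right hc.le h1')).trans ?_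
  rw [← mul_sub, ← Finset.sum_sub_distrib, abs_mul, abs_of_pos hc]
  have h2 : |∑ r ∈ Finset.Ico 1 t, ((L θ : ℝ) ^ β r * (z r)⁻¹ - (L θ : ℝ) ^ β r * (z' r)⁻¹)| ≤
      M * ∑ r ∈ Finset.Ico 1 t, |(z r)⁻¹ - (z' r)⁻¹| := by
    rw [Finset.mul_sum]
    refine (Finset.abs_sum_le_sum_abs _ _).trans (Finset.sum_le_sum fun r hr => ?_)
    rw [← mul_sub, abs_mul, abs_of_nonneg (by positivity)]
    have := Finset.mem_Ico.1 hr
    exact mul_le_mul_of_nonneg_right (hM r (by simp; omega) θ) (abs_nonneg _)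
  calc M / (1 / ((t : ℝ) - 1)) ^ 2 * (1 / ((t : ℝ) - 1) * _)
      ≤ M / (1 / ((t : ℝ) - 1)) ^ 2 * (1 / ((t : ℝ) - 1) *
        (M * ∑ r ∈ Finset.Ico 1 t, |(z r)⁻¹ - (z' r)⁻¹|)) := by gcongr
    _ = _ := by field_simp

theorem measurable_weightAt {Θ : Type*} [MeasurableSpace Θ] {L : Θ → ℝ≥0} (hL : Measurable L)
    (β : ℕ → ℝ) (z : ℕ → ℝ) (t : ℕ) : Measurable (weightAt L β z t) :=
  (measurable_rpow hL _).div
    ((Finset.measurable_sum _ fun _ _ => (measurable_rpow hL _).mul_const _).const_mul _)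

theorem abs_weightAt_le {Θ : Type*} {L : Θ → ℝ≥0} {β : ℕ → ℝ} (hβ_one : β 1 = 0)
    {t : ℕ} (ht : 2 ≤ t) {M : ℝ} (hM : ∀ θ, (L θ : ℝ) ^ β t ≤ M)
    {z : ℕ → ℝ} (hz1 : z 1 = 1) (hz : ∀ r ∈ Finset.Ico 1 t, 0 ≤ z r) (θ : Θ) :
    |weightAt L β z t θ| ≤ M * ((t : ℝ) - 1) := by
  have ht' : (0 : ℝ) < (t : ℝ) - 1 := by
    have : (2 : ℝ) ≤ t := by exact_mod_cast ht
    linarith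
  have h1 := one_le_sum_rpow_mul_inv L hβ_one hz1 hz ht θ
  have hc : 0 < 1 / ((t : ℝ) - 1) := by positivity
  rw [weightAt, abs_of_nonneg (by positivity)]
  have hM0 : 0 ≤ M := le_trans (by positivity) (hM θ)
  calc _ ≤ M / (1 / ((t : ℝ) - 1)) := by
        gcongr
        · exact hM θ
        · exact le_mul_of_one_le_right hc.le h1
    _ = _ := by field_simp

theorem normConst_one {Θ : Type*} [MeasurableSpace Θ] (prior : Measure Θ)
    [IsProbabilityMeasure prior] (L : Θ → ℝ≥0) {β : ℕ → ℝ} (hβ_one : β 1 = 0) :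
    normConst prior L β 1 = 1 := by
  simp [normConst, hβ_one]

/-- The balance-heuristic identity: the mixture density of the earlier targets cancels the
denominator of the weight pointwise. -/
theorem mixture_integral_weightAt {Θ : Type*} [MeasurableSpace Θ] {prior : Measure Θ}
    [IsProbabilityMeasure prior] {L : Θ → ℝ≥0} (hL : Measurable L) {β : ℕ → ℝ} (hβ_one : β 1 = 0)
    {t : ℕ} (ht : 2 ≤ t) {M : ℝ} (hM : ∀ r ∈ Finset.Icc 1 t, ∀ θ, (L θ : ℝ) ^ β r ≤ M)
    (hZ : ∀ r ∈ Finset.Ico 1 t, 0 < normConst prior L β r)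
    {g : Θ → ℝ} (hg : Measurable g) {C : ℝ} (hC : ∀ θ, |g θ| ≤ C) :
    1 / ((t : ℝ) - 1) * ∑ s ∈ Finset.Ico 1 t,
        ∫ θ, weightAt L β (normConst prior L β) t θ * g θ ∂(target prior L β s) =
      ∫ θ, (L θ : ℝ) ^ β t * g θ ∂prior := by
  have ht' : (0 : ℝ) < (t : ℝ) - 1 := by
    have : (2 : ℝ) ≤ t := by exact_mod_cast ht
    linarith
  set Z := normConst prior L β with hZdef
  have hZ1 : Z 1 = 1 := normConst_one prior L hβ_one
  have hint : ∀ s ∈ Finset.Ico 1 t, Integrable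
      (fun θ => (Z s)⁻¹ * ((L θ : ℝ) ^ β s * (weightAt L β Z t θ * g θ))) prior := by
    intro s hs
    have hs' := Finset.mem_Ico.1 hs
    refine Integrable.const_mul ?_ _
    refine Integrable.of_bound ((measurable_rpow hL _).mul
      ((measurable_weightAt hL β Z t).mul hg)).aestronglyMeasurable
      (M * (M * ((t : ℝ) - 1) * C)) (Eventually.of_forall fun θ => ?_)
    have hw := abs_weightAt_le hβ_one ht (hM t (by simp; omega)) hZ1 (fun r hr => (hZ r hr).le) θ
    have hM0 : 0 ≤ M := le_trans (by positivity) (hM t (by simp; omega) θ)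
    rw [norm_mul, norm_mul, Real.norm_eq_abs, Real.norm_eq_abs, Real.norm_eq_abs,
      abs_of_nonneg (show 0 ≤ (L θ : ℝ) ^ β s by positivity)]
    have := hM s (by simp; omega) θ
    have := hC θ
    gcongr
  have hsum : ∑ s ∈ Finset.Ico 1 t, ∫ θ, weightAt L β Z t θ * g θ ∂(target prior L β s) =
      ∫ θ, ∑ s ∈ Finset.Ico 1 t,
        (Z s)⁻¹ * ((L θ : ℝ) ^ β s * (weightAt L β Z t θ * g θ)) ∂prior := by
    rw [integral_finsetSum _ hint]
    refine Finset.sum_congr rfl fun s hs => ?_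
    rw [integral_target prior hL β (hZ s hs), ← integral_const_mul]
  rw [hsum, ← integral_const_mul]
  refine integral_congr_ae (Eventually.of_forall fun θ => ?_)
  have h1 := one_le_sum_rpow_mul_inv L hβ_one hZ1 (fun r hr => (hZ r hr).le) ht θ
  have h2 : ∑ s ∈ Finset.Ico 1 t, (Z s)⁻¹ * ((L θ : ℝ) ^ β s * (weightAt L β Z t θ * g θ)) =
      (∑ r ∈ Finset.Ico 1 t, (L θ : ℝ) ^ β r * (Z r)⁻¹) * (weightAt L β Z t θ * g θ) := by
    rw [Finset.sum_mul]
    exact Finset.sum_congr rfl fun s _ => by ring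
  simp only [h2]
  have h0 : (0 : ℝ) < ∑ r ∈ Finset.Ico 1 t, (L θ : ℝ) ^ β r * (Z r)⁻¹ := by linarith
  rw [weightAt]
  generalize ∑ r ∈ Finset.Ico 1 t, (L θ : ℝ) ^ β r * (Z r)⁻¹ = S at h0
  field_simp

/-- The weighted average of `g` over all particles of the generations before `t`. -/
noncomputable def weightedAverage {Θ : Type*} (L : Θ → ℝ≥0) (β : ℕ → ℝ) {N : ℕ}
    (x : ℕ → Fin N → Θ) (t : ℕ) (g : Θ → ℝ) : ℝ :=
  1 / ((t : ℝ) - 1) * ∑ s ∈ Finset.Ico 1 t, (1 / (N : ℝ) * ∑ i, weight L β x t s i * g (x s i))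

theorem zHat_eq_weightedAverage {Θ : Type*} (L : Θ → ℝ≥0) (β : ℕ → ℝ) {N : ℕ}
    (x : ℕ → Fin N → Θ) {t : ℕ} (ht : 2 ≤ t) :
    zHat L β x t = weightedAverage L β x t fun _ => 1 := by
  simp [zHat_eq _ _ _ _ ht, weightedAverage]

theorem resampleProb_eq {Θ : Type*} (L : Θ → ℝ≥0) (β : ℕ → ℝ) {N : ℕ}
    (x : ℕ → Fin N → Θ) {t : ℕ} (ht : 2 ≤ t) (B : Set Θ) :
    resampleProb L β x t B =
      weightedAverage L β x t (B.indicator fun _ => 1) / zHat L β x t := by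
  -- If the estimate vanishes, both sides are `0` through division by zero; otherwise none of the
  -- factors of the estimate vanishes.
  by_cases h : zHat L β x t = 0
  · simp [resampleProb, normWeight, h]
  have hz := zHat_eq L β x t ht
  simp only [← Finset.mul_sum] at hz
  simp only [resampleProb, normWeight, weightedAverage, ← Finset.sum_div, ← Finset.mul_sum]
  set S := ∑ s ∈ Finset.Ico 1 t, ∑ i, weight L β x t s i with hS
  have hS0 : S ≠ 0 := by rintro h0; simp [h0] at hz; exact h hz
  have hN0 : (N : ℝ) ≠ 0 := by rintro h0; simp [h0] at hz; exact h hz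
  have ht0 : (t : ℝ) - 1 ≠ 0 := by rintro h0; simp [h0] at hz; exact h hz
  have e : ∀ s i, weight L β x t s i / zHat L β x t / (S / zHat L β x t) *
      B.indicator (fun _ => (1 : ℝ)) (x s i) =
      S⁻¹ * (weight L β x t s i * B.indicator (fun _ => (1 : ℝ)) (x s i)) := by
    intro s i
    rw [div_div_div_cancel_right₀ h]
    ring
  simp only [e, ← Finset.mul_sum]
  rw [hz]
  field_simp

/-- Exact weights give a fixed bounded test function, to which the convergence of the empirical
measures applies; the random weights are then compared with it. -/
theorem tendsto_weightedAverage {α Θ : Type*} [MeasurableSpace Θ] {l : Filter α}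
    {prior : Measure Θ} [IsProbabilityMeasure prior] {L : Θ → ℝ≥0} (hL : Measurable L)
    {β : ℕ → ℝ} (hβ_one : β 1 = 0) {t : ℕ} (ht : 2 ≤ t) {M : ℝ}
    (hM : ∀ r ∈ Finset.Icc 1 t, ∀ θ, (L θ : ℝ) ^ β r ≤ M)
    (hZ : ∀ r ∈ Finset.Ico 1 t, 0 < normConst prior L β r)
    {N : α → ℕ} {x : ∀ a, ℕ → Fin (N a) → Θ}
    (hz : ∀ r ∈ Finset.Ico 1 t,
      Tendsto (fun a => zHat L β (x a) r) l (𝓝 (normConst prior L β r)))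
    (hx : ∀ r ∈ Finset.Ico 1 t, ∀ B, MeasurableSet B →
      Tendsto (fun a => average (x a r) (B.indicator fun _ => 1)) l
        (𝓝 ((target prior L β r).real B)))
    {g : Θ → ℝ} (hg : Measurable g) (hC : ∀ θ, |g θ| ≤ 1) :
    Tendsto (fun a => weightedAverage L β (x a) t g) l
      (𝓝 (∫ θ, (L θ : ℝ) ^ β t * g θ ∂prior)) := by
  have ht' : (0 : ℝ) < (t : ℝ) - 1 := by
    have : (2 : ℝ) ≤ t := by exact_mod_cast ht
    linarith
  set Z := normConst prior L β with hZdef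
  have hZ1 : Z 1 = 1 := normConst_one prior L hβ_one
  have hZ0 : ∀ r ∈ Finset.Ico 1 t, 0 ≤ Z r := fun r hr => (hZ r hr).le
  have htt : t ∈ Finset.Icc 1 t := by simp; omega
  have hlim : Tendsto (fun a => 1 / ((t : ℝ) - 1) * ∑ s ∈ Finset.Ico 1 t,
      average (x a s) (fun θ => weightAt L β Z t θ * g θ)) l
      (𝓝 (∫ θ, (L θ : ℝ) ^ β t * g θ ∂prior)) := by
    rw [← mixture_integral_weightAt hL hβ_one ht hM hZ hg hC]
    refine (tendsto_finsetSum _ fun s hs => ?_).const_mul _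
    have := isProbabilityMeasure_target prior (hZ s hs)
    refine tendsto_average (C := M * ((t : ℝ) - 1) * 1) (hx s hs)
      ((measurable_weightAt hL β Z t).mul hg) fun θ => ?_
    have hM0 : 0 ≤ M := le_trans (by positivity) (hM t htt θ)
    rw [abs_mul]
    exact mul_le_mul (abs_weightAt_le hβ_one ht (hM t htt) hZ1 hZ0 θ) (hC θ) (abs_nonneg _)
      (by positivity)
  refine hlim.congr_dist ?_
  have hbound : Tendsto (fun a => M ^ 2 * ((t : ℝ) - 1) *
      ∑ r ∈ Finset.Ico 1 t, |(Z r)⁻¹ - (zHat L β (x a) r)⁻¹|) l (𝓝 0) := by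
    have h0 : ∀ r ∈ Finset.Ico 1 t,
        Tendsto (fun a => |(Z r)⁻¹ - (zHat L β (x a) r)⁻¹|) l (𝓝 0) := by
      intro r hr
      simpa using (((hz r hr).inv₀ (hZ r hr).ne').const_sub (Z r)⁻¹).abs
    simpa using (tendsto_finsetSum _ h0).const_mul (M ^ 2 * ((t : ℝ) - 1))
  refine squeeze_zero (fun _ => dist_nonneg) (fun a => ?_) hbound
  set b := M ^ 2 * ((t : ℝ) - 1) *
      ∑ r ∈ Finset.Ico 1 t, |(Z r)⁻¹ - (zHat L β (x a) r)⁻¹| with hb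
  have hb0 : 0 ≤ b := by positivity
  have hw : ∀ s i, |weightAt L β Z t (x a s i) * g (x a s i) -
      weight L β (x a) t s i * g (x a s i)| ≤ b := by
    intro s i
    rw [← sub_mul, abs_mul]
    have h1 := abs_weightAt_sub_le hβ_one ht hM hZ1 (zHat_one L β (x a)) hZ0
      (fun r _ => zHat_nonneg L β (x a) r) (x a s i)
    exact (mul_le_of_le_one_right (abs_nonneg _) (hC _)).trans h1
  rw [Real.dist_eq, weightedAverage, ← mul_sub, ← Finset.sum_sub_distrib, abs_mul,
    abs_of_pos (by positivity), one_div, inv_mul_le_iff₀ ht']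
  have hrow : ∀ s ∈ Finset.Ico 1 t, |average (x a s) (fun θ => weightAt L β Z t θ * g θ) -
      1 / (N a : ℝ) * ∑ i, weight L β (x a) t s i * g (x a s i)| ≤ b := by
    intro s _
    rw [average, ← mul_sub, ← Finset.sum_sub_distrib, abs_mul, abs_of_nonneg (by positivity)]
    have h2 : |∑ i, (weightAt L β Z t (x a s i) * g (x a s i) -
        weight L β (x a) t s i * g (x a s i))| ≤ N a * b := by
      refine (Finset.abs_sum_le_sum_abs _ _).trans ?_
      refine (Finset.sum_le_card_nsmul _ _ b fun i _ => hw s i).trans (by simp)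
    rcases Nat.eq_zero_or_pos (N a) with hN | hN
    · simpa [hN] using hb0
    · have hN' : (0 : ℝ) < N a := by exact_mod_cast hN
      rw [one_div, inv_mul_le_iff₀ hN']
      exact h2
  refine (Finset.abs_sum_le_sum_abs _ _).trans ?_
  -- There are `t - 1` earlier generations, which matches the prefactor.
  refine (Finset.sum_le_card_nsmul _ _ b hrow).trans (le_of_eq ?_)
  rw [Nat.card_Ico, nsmul_eq_mul, Nat.cast_sub (by omega), Nat.cast_one]

/-! ### Runs of the algorithm -/

theorem past_le {Ω Θ : Type*} [m₀ : MeasurableSpace Ω] [MeasurableSpace Θ] {N : ℕ}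
    {θ θres : ℕ → Fin N → Ω → Θ} {t : ℕ}
    (hθ : ∀ s ∈ Finset.Ico 1 t, ∀ i, Measurable (θ s i))
    (hθres : ∀ s ∈ Finset.Ico 2 t, ∀ i, Measurable (θres s i)) : past θ θres t ≤ m₀ :=
  sup_le (iSup₂_le fun s hs => (measurable_pi_lambda _ (hθ s hs)).comap_le)
    (iSup₂_le fun s hs => (measurable_pi_lambda _ (hθres s hs)).comap_le)

theorem resampleProb_univ {Θ : Type*} {L : Θ → ℝ≥0} (hpos : ∀ θ, 0 < L θ) {β : ℕ → ℝ}
    (hβ_one : β 1 = 0) {N : ℕ} [NeZero N] (x : ℕ → Fin N → Θ) {t : ℕ} (ht : 2 ≤ t) :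
    resampleProb L β x t Set.univ = 1 := by
  rw [resampleProb_eq L β x ht, Set.indicator_univ, ← zHat_eq_weightedAverage L β x ht,
    div_self (zHat_pos hpos hβ_one x ht).ne']

section

variable {Θ : Type*} [MeasurableSpace Θ] {prior : Measure Θ}
  {L : Θ → ℝ≥0} {T : ℕ} {β : ℕ → ℝ} {K : ℕ → Kernel Θ Θ}
  {Ω : ℕ → Type*} [∀ N, MeasurableSpace (Ω N)]
  {P : ∀ N, Measure (Ω N)} [∀ N, IsProbabilityMeasure (P N)]
  {θ θres : ∀ N : ℕ, ℕ → Fin N → Ω N → Θ}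

theorem tendsto_average_resampled (hL : Measurable L) (hβ_one : β 1 = 0) (hpos : ∀ θ, 0 < L θ)
    (hrun : ∀ N, IsRun (P N) prior L β K T N (θ N) (θres N)) {t : ℕ} (ht : t ∈ Finset.Icc 2 T)
    (hZ : 0 < normConst prior L β t)
    (hz : Tendsto (fun p : Σ N, Ω N => zHat L β (fun s i => θ p.1 s i p.2) t)
      (inProbability P) (𝓝 (normConst prior L β t)))
    (hw : ∀ g : Θ → ℝ, Measurable g → (∀ y, |g y| ≤ 1) →
      Tendsto (fun p : Σ N, Ω N => weightedAverage L β (fun s i => θ p.1 s i p.2) t g)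
        (inProbability P) (𝓝 (∫ y, (L y : ℝ) ^ β t * g y ∂prior)))
    {B : Set Θ} (hB : MeasurableSet B) :
    Tendsto (fun p : Σ N, Ω N => average (fun i => θres p.1 t i p.2) (B.indicator fun _ => 1))
      (inProbability P) (𝓝 ((target prior L β t).real B)) := by
  have ht' := Finset.mem_Icc.1 ht
  have h := tendsto_average_sub_average (P := P) (Y := fun N i => θres N t i)
    (fun N => (hrun N).measurable_resampled t ht)
    (Q := fun N _ ω => resampleProb L β (fun s j => θ N s j ω) t)
    -- An index in `Fin N` excludes `N = 0`, where the resampling probabilities do not sum to one.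
    (fun N i ω => have : NeZero N := ⟨fun h => (h ▸ i).elim0⟩
      resampleProb_univ hpos hβ_one _ ht'.1)
    (fun N => ⟨past (θ N) (θres N) t, past_le
      (fun s hs => (hrun N).measurable_particle s (by simp at hs ⊢; omega))
      (fun s hs => (hrun N).measurable_resampled s (by simp at hs ⊢; omega)),
      (hrun N).resample t ht⟩) hB
  have hc : Tendsto (fun p : Σ N, Ω N => 1 / (p.1 : ℝ) *
      ∑ _i : Fin p.1, resampleProb L β (fun s j => θ p.1 s j p.2) t B)
      (inProbability P) (𝓝 ((target prior L β t).real B)) := by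
    rw [measureReal_target prior hL hZ hB, ← div_eq_inv_mul]
    refine ((hw _ (measurable_const.indicator hB) fun y => ?_).div hz hZ.ne').congr' ?_
    · by_cases hy : y ∈ B <;> simp [hy]
    · filter_upwards [(tendsto_fst_inProbability P).eventually (eventually_gt_atTop 0)] with p hp
      have : (p.1 : ℝ) ≠ 0 := by exact_mod_cast hp.ne'
      simp [this, resampleProb_eq L β _ ht'.1]
  simpa using h.add hc

variable [IsProbabilityMeasure prior]

/-- Unconditional independence is the case of the trivial σ-algebra, where conditional expectation
is the integral. -/
theorem tendsto_average_init (hβ_one : β 1 = 0) (hT : 1 ≤ T)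
    (hrun : ∀ N, IsRun (P N) prior L β K T N (θ N) (θres N))
    {B : Set Θ} (hB : MeasurableSet B) :
    Tendsto (fun p : Σ N, Ω N => average (fun i => θ p.1 1 i p.2) (B.indicator fun _ => 1))
      (inProbability P) (𝓝 ((target prior L β 1).real B)) := by
  rw [target_one prior L hβ_one]
  have hmeas : ∀ N i, Measurable (θ N 1 i) := fun N =>
    (hrun N).measurable_particle 1 (by simp [hT])
  have h := tendsto_average_sub_average (P := P) (Y := fun N i => θ N 1 i) hmeas
    (Q := fun _ _ _ => prior.real) (by simp) (fun N => ⟨⊥, bot_le, fun A hA => ?_⟩) hB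
  · have hc : Tendsto (fun p : Σ N, Ω N => 1 / (p.1 : ℝ) * ∑ _i : Fin p.1, prior.real B)
        (inProbability P) (𝓝 (prior.real B)) := by
      refine tendsto_const_nhds.congr' ?_
      filter_upwards [(tendsto_fst_inProbability P).eventually (eventually_gt_atTop 0)] with p hp
      have : (p.1 : ℝ) ≠ 0 := by exact_mod_cast hp.ne'
      simp [this]
    simpa using h.add hc
  · have hset : MeasurableSet {ω | ∀ i, θ N 1 i ω ∈ A i} := by
      rw [Set.ofPred_forall]
      exact MeasurableSet.iInter fun i => hmeas N i (hA i)
    have hpre : {ω | ∀ i, θ N 1 i ω ∈ A i} =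
        (fun ω i => θ N 1 i ω) ⁻¹' Set.univ.pi A := by
      ext ω; simp
    rw [condExp_bot, integral_indicator_const _ hset, hpre, ← map_measureReal_apply
      (measurable_pi_lambda _ (hmeas N)) (MeasurableSet.univ_pi hA), (hrun N).init]
    simp [Measure.real, Measure.pi_pi, ENNReal.toReal_prod]

variable [∀ t, IsMarkovKernel (K t)]

theorem tendsto_average_moved (hC3 : KernelsGeometricallyErgodic prior L β K T)
    (hrun : ∀ N, IsRun (P N) prior L β K T N (θ N) (θres N)) {t : ℕ} (ht : t ∈ Finset.Icc 2 T)
    (hZ : 0 < normConst prior L β t)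
    (hres : ∀ B, MeasurableSet B → Tendsto
      (fun p : Σ N, Ω N => average (fun i => θres p.1 t i p.2) (B.indicator fun _ => 1))
      (inProbability P) (𝓝 ((target prior L β t).real B)))
    {B : Set Θ} (hB : MeasurableSet B) :
    Tendsto (fun p : Σ N, Ω N => average (fun i => θ p.1 t i p.2) (B.indicator fun _ => 1))
      (inProbability P) (𝓝 ((target prior L β t).real B)) := by
  have ht' := Finset.mem_Icc.1 ht
  have ht1 : t ∈ Finset.Icc 1 T := by simp; omega
  have := isProbabilityMeasure_target prior hZ
  have h := tendsto_average_sub_average (P := P) (Y := fun N i => θ N t i)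
    (fun N => (hrun N).measurable_particle t ht1)
    (Q := fun N i ω => (K t (θres N t i ω)).real) (by simp)
    (fun N => ⟨past (θ N) (θres N) t ⊔
        MeasurableSpace.comap (fun ω i => θres N t i ω) inferInstance, sup_le (past_le
      (fun s hs => (hrun N).measurable_particle s (by simp at hs ⊢; omega))
      (fun s hs => (hrun N).measurable_resampled s (by simp at hs ⊢; omega)))
      (measurable_pi_lambda _ ((hrun N).measurable_resampled t ht)).comap_le,
      (hrun N).move t ht⟩) hB
  have hc := tendsto_average hres (g := fun y => (K t y).real B)
    ((K t).measurable_coe hB).ennreal_toReal (C := 1) fun y => by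
      rw [abs_of_nonneg measureReal_nonneg]; exact measureReal_le_one
  rw [integral_kernel_target hC3 ht1 hZ hB] at hc
  simpa [average] using h.add hc

/-- The estimate at `t` needs both conclusions for all earlier generations, and the empirical
measure at `t` needs the estimate at `t`. -/
theorem tendsto_zHat_and_average (hL : Measurable L) (hβ_one : β 1 = 0) (hpos : ∀ θ, 0 < L θ)
    {M : ℝ} (hM : ∀ r ∈ Finset.Icc 1 T, ∀ θ, (L θ : ℝ) ^ β r ≤ M)
    (hZ : ∀ r ∈ Finset.Icc 1 T, 0 < normConst prior L β r)
    (hC3 : KernelsGeometricallyErgodic prior L β K T)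
    (hrun : ∀ N, IsRun (P N) prior L β K T N (θ N) (θres N)) {t : ℕ} (ht : t ∈ Finset.Icc 1 T) :
    Tendsto (fun p : Σ N, Ω N => zHat L β (fun s i => θ p.1 s i p.2) t)
        (inProbability P) (𝓝 (normConst prior L β t)) ∧
      ∀ B, MeasurableSet B → Tendsto
        (fun p : Σ N, Ω N => average (fun i => θ p.1 t i p.2) (B.indicator fun _ => 1))
        (inProbability P) (𝓝 ((target prior L β t).real B)) := by
  induction t using Nat.strong_induction_on with
  | _ t ih =>
    have ht' := Finset.mem_Icc.1 ht
    rcases ht'.1.eq_or_lt with rfl | ht2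
    · simp only [zHat_one, normConst_one prior L hβ_one]
      exact ⟨tendsto_const_nhds, fun B hB => tendsto_average_init hβ_one ht'.2 hrun hB⟩
    have ih' : ∀ r ∈ Finset.Ico 1 t, _ := fun r hr =>
      ih r (Finset.mem_Ico.1 hr).2 (by simp at hr ⊢; omega)
    have hw : ∀ g : Θ → ℝ, Measurable g → (∀ y, |g y| ≤ 1) →
        Tendsto (fun p : Σ N, Ω N => weightedAverage L β (fun s i => θ p.1 s i p.2) t g)
          (inProbability P) (𝓝 (∫ y, (L y : ℝ) ^ β t * g y ∂prior)) := fun g hg hg1 =>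
      tendsto_weightedAverage hL hβ_one ht2 (fun r hr => hM r (by simp at hr ⊢; omega))
        (fun r hr => hZ r (by simp at hr ⊢; omega)) (fun r hr => (ih' r hr).1)
        (fun r hr => (ih' r hr).2) hg hg1
    have hz : Tendsto (fun p : Σ N, Ω N => zHat L β (fun s i => θ p.1 s i p.2) t)
        (inProbability P) (𝓝 (normConst prior L β t)) := by
      simpa [zHat_eq_weightedAverage _ _ _ ht2, normConst] using
        hw (fun _ => 1) measurable_const (by simp)
    have ht2' : t ∈ Finset.Icc 2 T := Finset.mem_Icc.2 ⟨ht2, ht'.2⟩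
    exact ⟨hz, fun B hB => tendsto_average_moved hC3 hrun ht2' (hZ t ht)
      (fun A hA => tendsto_average_resampled hL hβ_one hpos hrun ht2' (hZ t ht) hz hw hA) hB⟩

end

end PersistentSampling

theorem mainTheorem1 {Θ : Type*} [MeasurableSpace Θ]
    (prior : Measure Θ) [IsProbabilityMeasure prior]
    (L : Θ → ℝ≥0) (hL : Measurable L)
    (T : ℕ) (β : ℕ → ℝ) (hβ_one : β 1 = 0) (hβ_T : β T = 1)
    (K : ℕ → Kernel Θ Θ) [∀ t, IsMarkovKernel (K t)]
    (hC1 : PersistentSampling.LikelihoodRatioBounded L β T)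
    (hC2 : PersistentSampling.NormConstPositive prior L β T)
    (hC3 : PersistentSampling.KernelsGeometricallyErgodic prior L β K T)
    (hC4 : PersistentSampling.StepsBoundedBelow β T)
    {Ω : ℕ → Type*} [∀ N, MeasurableSpace (Ω N)]
    (P : ∀ N, Measure (Ω N)) [∀ N, IsProbabilityMeasure (P N)]
    (θ θres : ∀ N : ℕ, ℕ → Fin N → Ω N → Θ)
    (hrun : ∀ N, PersistentSampling.IsRun (P N) prior L β K T N (θ N) (θres N))
    (t : ℕ) (ht : t ∈ Finset.Icc 1 T) :
    PersistentSampling.TendstoInProbability P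
      (fun N ω => PersistentSampling.zHat L β (fun s i => θ N s i ω) t)
      (PersistentSampling.normConst prior L β t) := by

  have hT : 1 ≤ T := (Finset.mem_Icc.1 ht).1.trans (Finset.mem_Icc.1 ht).2
  have hpos := hC1.pos hβ_one hβ_T hT
  obtain ⟨M, hM⟩ := hC1.exists_bound hβ_one hpos
  obtain ⟨ε, hε, hεZ⟩ := hC2
  exact PersistentSampling.tendstoInProbability_iff.2
    (PersistentSampling.tendsto_zHat_and_average hL hβ_one hpos hM
      (fun r hr => hε.trans_le (hεZ r hr)) hC3 hrun ht).1
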